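/- Proposition 7.3. Let $\Sigma=\biguplus_{n\ge 0}\Sigma_n$ be a topological signature (each set $\Sigma_n$ of $n$-ary operation symbols is a topological space), and let $X$ be a nonempty topological space. A topological $\Sigma$-algebra is a nonempty set $S$ with a topology and with operations such that every evaluation mapping $\Sigma_n\times S^n\to S$ is continuous; it is profinite if it is compact Hausdorff and its points are separated by continuous homomorphisms into finite discrete $\Sigma$-algebras. Profinite monoids are defined analogously. Let $F$ be the free profinite $\Sigma$-algebra over $X$, with generating mapping $\iota:X\to F$, and let $N$ be the free profinite monoid over the topological sum $X\cup\Sigma$ of $X$ and all the $\Sigma_n$, with generating mapping $\eta:X\cup\Sigma\to N$. Regard $N$ as a profinite $\Sigma$-algebra through $$w(m_1,\dots,m_n)=\eta(w)\,m_1\cdots m_n\qquad(w\in\Sigma_n,\ m_1,\dots,m_n\in N),$$ and let $S$ be the closed subalgebra of $N$ generated by $\eta(X)$. The Polish representation is the unique continuous homomorphism of $\Sigma$-algebras $\Phi_X:F\to S$ such that $\Phi_X(\iota(x))=\eta(x)$ for all $x\in X$. If $\Sigma$ contains at least one operation symbol of arity at least $2$, then $\Phi_X$ is not injective. -/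

import Mathlib

open scoped FirstOrder
open FirstOrder.Language

universe u v w x y

/-!
A signature is a first-order language `L` without relation symbols (`L.IsAlgebraic`), with
`L.Functions n` the set of `n`-ary operation symbols.  A topological signature is one in which every
`L.Functions n` carries a topology.  A `Σ`-algebra is an `L.Structure`, a homomorphism is `S →[L] T`
and a subalgebra is an `L.Substructure`.
-/

namespace PolishRep

/-! ### Topological and profinite algebras -/

/-- The evaluation mappings `Σₙ × Sⁿ → S` are (jointly) continuous. -/
class IsTopologicalAlgebra (L : FirstOrder.Language.{u, v}) [∀ n, TopologicalSpace (L.Functions n)]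
    (S : Type w) [TopologicalSpace S] [L.Structure S] : Prop where
  continuous_funMap : ∀ n : ℕ, Continuous
    (fun p : L.Functions n × (Fin n → S) => (Structure.funMap p.1 p.2 : S))

/-- A profinite algebra: a nonempty compact Hausdorff topological algebra in which any two points
are separated by a continuous homomorphism into a finite (discrete) algebra. -/
class IsProfiniteAlgebra (L : FirstOrder.Language.{u, v}) [∀ n, TopologicalSpace (L.Functions n)]
    (S : Type w) [TopologicalSpace S] [L.Structure S] : Prop
    extends IsTopologicalAlgebra L S, CompactSpace S, T2Space S where
  nonempty : Nonempty S
  separated : ∀ s s' : S, s ≠ s' →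
    ∃ (T : Type) (_ : TopologicalSpace T) (_ : L.Structure T) (φ : S →[L] T),
      Finite T ∧ DiscreteTopology T ∧ IsTopologicalAlgebra L T ∧ Continuous φ ∧ φ s ≠ φ s'

/-- A profinite monoid: a compact Hausdorff topological monoid in which any two points are
separated by a continuous homomorphism into a finite (discrete) monoid. -/
class IsProfiniteMonoid (M : Type w) [TopologicalSpace M] [Monoid M] : Prop
    extends ContinuousMul M, CompactSpace M, T2Space M where
  separated : ∀ s s' : M, s ≠ s' →
    ∃ (T : Type) (_ : TopologicalSpace T) (_ : Monoid T) (φ : M →* T),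
      Finite T ∧ DiscreteTopology T ∧ Continuous φ ∧ φ s ≠ φ s'

/-- The closed subalgebra generated by a set: the least closed subalgebra containing it. -/
def closedSubalgebra (L : FirstOrder.Language.{u, v}) {S : Type w} [TopologicalSpace S] [L.Structure S]
    (s : Set S) : L.Substructure S :=
  sInf {T : L.Substructure S | s ⊆ T ∧ IsClosed (T : Set S)}

theorem subset_closedSubalgebra (L : FirstOrder.Language.{u, v}) {S : Type w} [TopologicalSpace S]
    [L.Structure S] (s : Set S) : s ⊆ closedSubalgebra L s := by
  intro a ha
  exact Substructure.mem_sInf.2 fun T hT => hT.1 ha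

theorem isClosed_closedSubalgebra (L : FirstOrder.Language.{u, v}) {S : Type w} [TopologicalSpace S]
    [L.Structure S] (s : Set S) : IsClosed (closedSubalgebra L s : Set S) := by
  rw [closedSubalgebra, Substructure.coe_sInf]
  exact isClosed_biInter fun T hT => hT.2

theorem closedSubalgebra_le (L : FirstOrder.Language.{u, v}) {S : Type w} [TopologicalSpace S]
    [L.Structure S] {s : Set S} {T : L.Substructure S} (h : s ⊆ T) (hT : IsClosed (T : Set S)) :
    closedSubalgebra L s ≤ T :=
  sInf_le ⟨h, hT⟩

/-- The product of a family of algebras, with componentwise operations. -/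
instance piStructure (L : FirstOrder.Language.{u, v}) {I : Type w} (A : I → Type x)
    [∀ i, L.Structure (A i)] : L.Structure (∀ i, A i) where
  funMap f a := fun i => Structure.funMap f fun k => a k i
  RelMap r a := ∀ i, Structure.RelMap r fun k => a k i

/-! ### The free profinite algebra over a topological space -/

/-- A continuous mapping from `X` to a finite discrete topological algebra.  Up to isomorphism it
is enough to consider algebras on the sets `{0, …, k}`, so that these form a small family. -/
structure FiniteAlgebraOver (L : FirstOrder.Language.{u, v}) [∀ n, TopologicalSpace (L.Functions n)]
    (X : Type w) [TopologicalSpace X] where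
  card : ℕ
  str : L.Structure (Fin (card + 1))
  top : IsTopologicalAlgebra L (Fin (card + 1))
  map : X → Fin (card + 1)
  continuous_map : Continuous map

section FreeAlgebra

variable (L : FirstOrder.Language.{u, v}) [∀ n, TopologicalSpace (L.Functions n)]
variable (X : Type w) [TopologicalSpace X]

/-- The underlying set of the finite algebra. -/
def FiniteAlgebraOver.Carrier {L : FirstOrder.Language.{u, v}} [∀ n, TopologicalSpace (L.Functions n)]
    {X : Type w} [TopologicalSpace X] (i : FiniteAlgebraOver L X) : Type :=
  Fin (i.card + 1)

instance (i : FiniteAlgebraOver L X) : TopologicalSpace i.Carrier :=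
  inferInstanceAs (TopologicalSpace (Fin (i.card + 1)))
instance (i : FiniteAlgebraOver L X) : DiscreteTopology i.Carrier :=
  inferInstanceAs (DiscreteTopology (Fin (i.card + 1)))
instance (i : FiniteAlgebraOver L X) : Finite i.Carrier :=
  inferInstanceAs (Finite (Fin (i.card + 1)))
instance (i : FiniteAlgebraOver L X) : L.Structure i.Carrier := i.str
instance (i : FiniteAlgebraOver L X) : IsTopologicalAlgebra L i.Carrier := i.top

/-- The image of a generator in the product of all finite algebras over `X`. -/
def freeAlgebraTuple (a : X) : ∀ i : FiniteAlgebraOver L X, i.Carrier := fun i => i.map a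

/-- The free profinite algebra over `X`, as the closed subalgebra generated by `X` in the product of
all finite discrete topological algebras equipped with a continuous mapping from `X`. -/
def freeProfiniteSubalgebra : L.Substructure (∀ i : FiniteAlgebraOver L X, i.Carrier) :=
  closedSubalgebra L (Set.range (freeAlgebraTuple L X))

/-- The free profinite algebra over the topological space `X`. -/
abbrev FreeProfiniteAlgebra : Type (max u v w) := freeProfiniteSubalgebra L X

variable {X}

/-- The natural generating mapping of the free profinite algebra. -/
def FreeProfiniteAlgebra.ι (a : X) : FreeProfiniteAlgebra L X :=
  ⟨freeAlgebraTuple L X a, subset_closedSubalgebra L _ ⟨a, rfl⟩⟩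

theorem FreeProfiniteAlgebra.continuous_ι : Continuous (ι L : X → FreeProfiniteAlgebra L X) :=
  Continuous.subtype_mk (continuous_pi fun i => i.continuous_map) _

instance : CompactSpace (FreeProfiniteAlgebra L X) :=
  isCompact_iff_compactSpace.1 (isClosed_closedSubalgebra L _).isCompact

instance : IsTopologicalAlgebra L (FreeProfiniteAlgebra L X) where
  continuous_funMap n := by
    refine Continuous.subtype_mk (continuous_pi fun i => ?_) _
    refine (IsTopologicalAlgebra.continuous_funMap (L := L) (S := i.Carrier) n).comp
      (continuous_fst.prodMk (continuous_pi fun k => ?_))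
    exact (continuous_apply i).comp
      (continuous_subtype_val.comp ((continuous_apply k).comp continuous_snd))

/-- The projection of the free profinite algebra to one of the finite algebras. -/
def FreeProfiniteAlgebra.proj [L.IsAlgebraic] (i : FiniteAlgebraOver L X) :
    FreeProfiniteAlgebra L X →[L] i.Carrier where
  toFun a := a.1 i
  map_fun' _ _ := rfl
  map_rel' r := isEmptyElim r

instance [L.IsAlgebraic] [Nonempty X] : IsProfiniteAlgebra L (FreeProfiniteAlgebra L X) where
  nonempty := (inferInstance : Nonempty X).map (FreeProfiniteAlgebra.ι L)
  separated s s' h := by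
    obtain ⟨i, hi⟩ : ∃ i, s.1 i ≠ s'.1 i := by
      by_contra! hc
      exact h (Subtype.ext (funext hc))
    exact ⟨i.Carrier, _, _, FreeProfiniteAlgebra.proj L i, inferInstance, inferInstance,
      inferInstance, (continuous_apply i).comp continuous_subtype_val, hi⟩

variable {L}

/-- The free profinite algebra has no proper closed subalgebra containing the generators. -/
theorem FreeProfiniteAlgebra.eq_top (T : L.Substructure (FreeProfiniteAlgebra L X))
    (hT : IsClosed (T : Set (FreeProfiniteAlgebra L X))) (h : ∀ a : X, ι L a ∈ T) : T = ⊤ := by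
  have key : freeProfiniteSubalgebra L X ≤
      T.map (freeProfiniteSubalgebra L X).subtype.toHom := by
    refine closedSubalgebra_le L ?_ ?_
    · rintro _ ⟨a, rfl⟩
      exact ⟨_, h a, rfl⟩
    · exact (isClosed_closedSubalgebra L _).isClosedEmbedding_subtypeVal.isClosedMap _ hT
  refine eq_top_iff.2 fun a _ => ?_
  obtain ⟨b, hb, hab⟩ := key a.2
  have : b = a := Subtype.ext hab
  exact this ▸ hb

theorem FreeProfiniteAlgebra.exists_lift_finite [L.IsAlgebraic]
    (T : Type) [TopologicalSpace T] [DiscreteTopology T] [Finite T] [Nonempty T]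
    [L.Structure T] [IsTopologicalAlgebra L T] (φ : X → T) (hφ : Continuous φ) :
    ∃ ψ : FreeProfiniteAlgebra L X →[L] T, Continuous ψ ∧ ∀ a, ψ (ι L a) = φ a := by
  obtain ⟨k, ⟨e⟩⟩ := Finite.exists_equiv_fin T
  obtain ⟨m, rfl⟩ : ∃ m, k = m + 1 := by
    cases k with
    | zero => exact ((IsEmpty.false (e (Classical.arbitrary T)))).elim
    | succ m => exact ⟨m, rfl⟩
  let : L.Structure (Fin (m + 1)) := e.inducedStructure
  let i : FiniteAlgebraOver L X :=
    { card := m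
      str := e.inducedStructure
      top := by
        refine ⟨fun n => ?_⟩
        have h1 := IsTopologicalAlgebra.continuous_funMap (L := L) (S := T) n
        have h2 : Continuous fun p : L.Functions n × (Fin n → Fin (m + 1)) =>
            (p.1, fun k => e.symm (p.2 k)) :=
          continuous_fst.prodMk (continuous_pi fun k =>
            continuous_of_discreteTopology.comp ((continuous_apply k).comp continuous_snd))
        exact (continuous_of_discreteTopology (f := e)).comp (h1.comp h2)
      map := fun a => e (φ a)
      continuous_map := continuous_of_discreteTopology.comp hφ }
  refine ⟨⟨fun a => e.symm (a.1 i), fun {n} f a => ?_, fun r => isEmptyElim r⟩, ?_, fun a => ?_⟩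
  · change e.symm (e (Structure.funMap f (e.symm ∘ fun k => (a k).1 i))) = _
    rw [e.symm_apply_apply]
    rfl
  · exact (continuous_of_discreteTopology (f := fun b : i.Carrier => e.symm b)).comp
      ((continuous_apply i).comp continuous_subtype_val)
  · exact e.symm_apply_apply _

/-- The equalizer of two continuous homomorphisms from the free profinite algebra is everything as
soon as it contains the generators. -/
theorem FreeProfiniteAlgebra.hom_ext [L.IsAlgebraic]
    {S : Type y} [TopologicalSpace S] [T2Space S] [L.Structure S]
    {ψ ψ' : FreeProfiniteAlgebra L X →[L] S} (h : Continuous ψ) (h' : Continuous ψ')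
    (hι : ∀ a, ψ (ι L a) = ψ' (ι L a)) : ψ = ψ' := by
  have := eq_top (ψ.eqLocus ψ') (isClosed_eq h h') hι
  ext a
  have ha : a ∈ ψ.eqLocus ψ' := this ▸ Substructure.mem_top a
  exact ha

/-- The universal property of the free profinite algebra. -/
theorem FreeProfiniteAlgebra.existsUnique_lift [L.IsAlgebraic]
    {S : Type y} [TopologicalSpace S] [L.Structure S] [IsProfiniteAlgebra L S]
    (φ : X → S) (hφ : Continuous φ) :
    ∃! ψ : FreeProfiniteAlgebra L X →[L] S, Continuous ψ ∧ ∀ a, ψ (ι L a) = φ a := by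
  let D : Set (FreeProfiniteAlgebra L X × S) :=
    {p | ∀ (T : Type) (_ : TopologicalSpace T) (_ : L.Structure T) (χ : S →[L] T)
      (ψ : FreeProfiniteAlgebra L X →[L] T), T2Space T → Continuous χ → Continuous ψ →
      (∀ a, ψ (ι L a) = χ (φ a)) → ψ p.1 = χ p.2}
  have hD : IsClosed D := by
    simp only [D, Set.ofPred_forall]
    refine isClosed_iInter fun T => isClosed_iInter fun _ => isClosed_iInter fun _ =>
      isClosed_iInter fun χ => isClosed_iInter fun ψ => isClosed_iInter fun _ =>
      isClosed_iInter fun hχ => isClosed_iInter fun hψ => isClosed_iInter fun _ => ?_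
    exact isClosed_eq (hψ.comp continuous_fst) (hχ.comp continuous_snd)
  have huniq : ∀ a s s', (a, s) ∈ D → (a, s') ∈ D → s = s' := by
    intro a s s' hs hs'
    by_contra hne
    obtain ⟨T, _, _, χ, _, _, _, hχ, hsep⟩ := IsProfiniteAlgebra.separated (L := L) s s' hne
    have : Nonempty T := ⟨χ s⟩
    obtain ⟨ψ, hψ, hψι⟩ := exists_lift_finite (L := L) T (fun a => χ (φ a)) (hχ.comp hφ)
    exact hsep ((hs T _ _ χ ψ inferInstance hχ hψ hψι).symm.trans
      (hs' T _ _ χ ψ inferInstance hχ hψ hψι))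
  have hmul : ∀ (n : ℕ) (f : L.Functions n) (a : Fin n → FreeProfiniteAlgebra L X)
      (s : Fin n → S), (∀ k, (a k, s k) ∈ D) →
      ((Structure.funMap f a, Structure.funMap f s) : FreeProfiniteAlgebra L X × S) ∈ D := by
    intro n f a s h T _ _ χ ψ h1 h2 h3 h4
    change ψ (Structure.funMap f a) = χ (Structure.funMap f s)
    rw [Hom.map_fun, Hom.map_fun]
    congr 1
    exact funext fun k => h k T _ _ χ ψ h1 h2 h3 h4
  let P : L.Substructure (FreeProfiniteAlgebra L X) :=
    { carrier := {a | ∃ s, (a, s) ∈ D}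
      fun_mem := by
        intro n f a ha
        choose s hs using ha
        exact ⟨_, hmul n f a s hs⟩ }
  have hP : P = ⊤ := by
    refine eq_top P ?_ fun a => ⟨φ a, fun T _ _ χ ψ _ _ _ h => h a⟩
    have : (P : Set (FreeProfiniteAlgebra L X)) = Prod.fst '' D := by
      ext a
      exact ⟨fun ⟨s, hs⟩ => ⟨(a, s), hs, rfl⟩, fun ⟨p, hp, hpa⟩ => ⟨p.2, by rw [← hpa]; exact hp⟩⟩
    rw [this]
    exact isClosedMap_fst_of_compactSpace _ hD
  have hex : ∀ a, ∃ s, (a, s) ∈ D := fun a => by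
    have ha : a ∈ P := hP ▸ Substructure.mem_top a
    exact ha
  choose g hg using hex
  refine ⟨⟨g, fun {n} f a => ?_, fun r => isEmptyElim r⟩, ⟨?_, fun a => ?_⟩, ?_⟩
  · exact huniq _ _ _ (hg _) (hmul n f a (g ∘ a) fun k => hg (a k))
  · refine continuous_iff_isClosed.2 fun C hC => ?_
    have : g ⁻¹' C = Prod.fst '' (D ∩ Prod.snd ⁻¹' C) := by
      ext a
      constructor
      · exact fun ha => ⟨(a, g a), ⟨hg a, ha⟩, rfl⟩
      · rintro ⟨⟨a', s⟩, ⟨h1, h2⟩, rfl⟩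
        change g a' ∈ C
        rwa [huniq _ _ _ (hg a') h1]
    exact this ▸ isClosedMap_fst_of_compactSpace _ (hD.inter (hC.preimage continuous_snd))
  · exact huniq _ _ _ (hg _) fun T _ _ χ ψ _ _ _ h => h a
  · rintro ψ ⟨hψ, hψι⟩
    ext a
    refine huniq a _ _ (fun T _ _ χ ψ' _ hχ hψ' h => ?_) (hg a)
    have : ψ' = χ.comp ψ := hom_ext hψ' (hχ.comp hψ) fun b => by
      rw [h b, Hom.comp_apply, hψι b]
    rw [this]
    rfl

/-- The continuous homomorphism induced by a continuous mapping into a profinite algebra. -/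
noncomputable def FreeProfiniteAlgebra.lift [L.IsAlgebraic]
    {S : Type y} [TopologicalSpace S] [L.Structure S] [IsProfiniteAlgebra L S]
    (φ : X → S) (hφ : Continuous φ) : FreeProfiniteAlgebra L X →[L] S :=
  (existsUnique_lift φ hφ).choose

theorem FreeProfiniteAlgebra.continuous_lift [L.IsAlgebraic]
    {S : Type y} [TopologicalSpace S] [L.Structure S] [IsProfiniteAlgebra L S]
    (φ : X → S) (hφ : Continuous φ) : Continuous (lift (L := L) φ hφ) :=
  (existsUnique_lift φ hφ).choose_spec.1.1

theorem FreeProfiniteAlgebra.lift_ι [L.IsAlgebraic]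
    {S : Type y} [TopologicalSpace S] [L.Structure S] [IsProfiniteAlgebra L S]
    (φ : X → S) (hφ : Continuous φ) (a : X) : lift (L := L) φ hφ (ι L a) = φ a :=
  (existsUnique_lift φ hφ).choose_spec.1.2 a

end FreeAlgebra

/-! ### The free profinite monoid over a topological space -/

/-- A continuous mapping from `Y` to a finite discrete monoid.  Up to isomorphism it is enough to
consider monoids on the sets `{0, …, k}`. -/
structure FiniteMonoidOver (Y : Type w) [TopologicalSpace Y] where
  card : ℕ
  str : Monoid (Fin (card + 1))
  map : Y → Fin (card + 1)
  continuous_map : Continuous map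

section FreeMonoid

/-- The underlying set of the finite monoid. -/
def FiniteMonoidOver.Carrier {Y : Type w} [TopologicalSpace Y] (i : FiniteMonoidOver Y) : Type :=
  Fin (i.card + 1)

variable (Y : Type w) [TopologicalSpace Y]

instance (i : FiniteMonoidOver Y) : TopologicalSpace i.Carrier :=
  inferInstanceAs (TopologicalSpace (Fin (i.card + 1)))
instance (i : FiniteMonoidOver Y) : DiscreteTopology i.Carrier :=
  inferInstanceAs (DiscreteTopology (Fin (i.card + 1)))
instance (i : FiniteMonoidOver Y) : Finite i.Carrier :=
  inferInstanceAs (Finite (Fin (i.card + 1)))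
instance (i : FiniteMonoidOver Y) : Monoid i.Carrier := i.str

/-- The image of a generator in the product of all finite monoids over `Y`. -/
def freeMonoidTuple (a : Y) : ∀ i : FiniteMonoidOver Y, i.Carrier := fun i => i.map a

/-- The free profinite monoid over `Y`, as the closed submonoid generated by `Y` in the product of
all finite discrete monoids equipped with a continuous mapping from `Y`. -/
def freeProfiniteSubmonoid : Submonoid (∀ i : FiniteMonoidOver Y, i.Carrier) :=
  (Submonoid.closure (Set.range (freeMonoidTuple Y))).topologicalClosure

/-- The free profinite monoid over the topological space `Y`. -/
abbrev FreeProfiniteMonoid : Type w := freeProfiniteSubmonoid Y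

variable {Y}

/-- The natural generating mapping of the free profinite monoid. -/
def FreeProfiniteMonoid.η (a : Y) : FreeProfiniteMonoid Y :=
  ⟨freeMonoidTuple Y a, Submonoid.le_topologicalClosure _ (Submonoid.subset_closure ⟨a, rfl⟩)⟩

theorem FreeProfiniteMonoid.continuous_η : Continuous (η : Y → FreeProfiniteMonoid Y) :=
  Continuous.subtype_mk (continuous_pi fun i => i.continuous_map) _

instance : CompactSpace (FreeProfiniteMonoid Y) :=
  isCompact_iff_compactSpace.1 (Submonoid.isClosed_topologicalClosure _).isCompact

instance : IsProfiniteMonoid (FreeProfiniteMonoid Y) where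
  separated s s' h := by
    obtain ⟨i, hi⟩ : ∃ i, s.1 i ≠ s'.1 i := by
      by_contra! hc
      exact h (Subtype.ext (funext hc))
    exact ⟨i.Carrier, _, _, (Pi.evalMonoidHom _ i).comp (Submonoid.subtype _), inferInstance,
      inferInstance, (continuous_apply i).comp continuous_subtype_val, hi⟩

theorem FreeProfiniteMonoid.eq_top (T : Submonoid (FreeProfiniteMonoid Y))
    (hT : IsClosed (T : Set (FreeProfiniteMonoid Y))) (h : ∀ a : Y, η a ∈ T) : T = ⊤ := by
  have key : freeProfiniteSubmonoid Y ≤ T.map (freeProfiniteSubmonoid Y).subtype := by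
    refine Submonoid.topologicalClosure_minimal _ (Submonoid.closure_le.2 ?_) ?_
    · rintro _ ⟨a, rfl⟩
      exact ⟨_, h a, rfl⟩
    · exact (Submonoid.isClosed_topologicalClosure _).isClosedEmbedding_subtypeVal.isClosedMap _ hT
  refine eq_top_iff.2 fun a _ => ?_
  obtain ⟨b, hb, hab⟩ := key a.2
  have : b = a := Subtype.ext hab
  exact this ▸ hb

theorem FreeProfiniteMonoid.exists_lift_finite
    (T : Type) [TopologicalSpace T] [DiscreteTopology T] [Finite T] [Monoid T]
    (φ : Y → T) (hφ : Continuous φ) :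
    ∃ ψ : FreeProfiniteMonoid Y →* T, Continuous ψ ∧ ∀ a, ψ (η a) = φ a := by
  obtain ⟨k, ⟨e⟩⟩ := Finite.exists_equiv_fin T
  obtain ⟨m, rfl⟩ : ∃ m, k = m + 1 := by
    cases k with
    | zero => exact ((IsEmpty.false (e 1))).elim
    | succ m => exact ⟨m, rfl⟩
  let i : FiniteMonoidOver Y :=
    { card := m
      str := e.symm.monoid
      map := fun a => e (φ a)
      continuous_map := continuous_of_discreteTopology.comp hφ }
  let q : i.Carrier →* T :=
    { toFun := fun b => e.symm b
      map_one' := e.symm_apply_apply 1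
      map_mul' := fun a b => e.symm_apply_apply (e.symm a * e.symm b) }
  refine ⟨q.comp ((Pi.evalMonoidHom _ i).comp (Submonoid.subtype _)), ?_, fun a => ?_⟩
  · exact (continuous_of_discreteTopology (f := q)).comp
      ((continuous_apply i).comp continuous_subtype_val)
  · exact e.symm_apply_apply _

/-- The universal property of the free profinite monoid. -/
theorem FreeProfiniteMonoid.existsUnique_lift
    {S : Type y} [TopologicalSpace S] [Monoid S] [IsProfiniteMonoid S]
    (φ : Y → S) (hφ : Continuous φ) :
    ∃! ψ : FreeProfiniteMonoid Y →* S, Continuous ψ ∧ ∀ a, ψ (η a) = φ a := by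
  let D : Set (FreeProfiniteMonoid Y × S) :=
    {p | ∀ (T : Type) (_ : TopologicalSpace T) (_ : Monoid T) (χ : S →* T)
      (ψ : FreeProfiniteMonoid Y →* T), T2Space T → Continuous χ → Continuous ψ →
      (∀ a, ψ (η a) = χ (φ a)) → ψ p.1 = χ p.2}
  have hD : IsClosed D := by
    simp only [D, Set.ofPred_forall]
    refine isClosed_iInter fun T => isClosed_iInter fun _ => isClosed_iInter fun _ =>
      isClosed_iInter fun χ => isClosed_iInter fun ψ => isClosed_iInter fun _ =>
      isClosed_iInter fun hχ => isClosed_iInter fun hψ => isClosed_iInter fun _ => ?_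
    exact isClosed_eq (hψ.comp continuous_fst) (hχ.comp continuous_snd)
  have huniq : ∀ a s s', (a, s) ∈ D → (a, s') ∈ D → s = s' := by
    intro a s s' hs hs'
    by_contra hne
    obtain ⟨T, _, _, χ, _, _, hχ, hsep⟩ := IsProfiniteMonoid.separated s s' hne
    obtain ⟨ψ, hψ, hψι⟩ := exists_lift_finite T (fun a => χ (φ a)) (hχ.comp hφ)
    exact hsep ((hs T _ _ χ ψ inferInstance hχ hψ hψι).symm.trans
      (hs' T _ _ χ ψ inferInstance hχ hψ hψι))
  have hone : ((1, 1) : FreeProfiniteMonoid Y × S) ∈ D := by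
    intro T _ _ χ ψ _ _ _ _
    exact (map_one ψ).trans (map_one χ).symm
  have hmul : ∀ (a b : FreeProfiniteMonoid Y) (s t : S), (a, s) ∈ D → (b, t) ∈ D →
      (a * b, s * t) ∈ D := by
    intro a b s t h h' T _ _ χ ψ h1 h2 h3 h4
    have e1 : ψ a = χ s := h T _ _ χ ψ h1 h2 h3 h4
    have e2 : ψ b = χ t := h' T _ _ χ ψ h1 h2 h3 h4
    change ψ (a * b) = χ (s * t)
    rw [map_mul, map_mul, e1, e2]
  have hgen : ∀ a, (η a, φ a) ∈ D := fun a T _ _ χ ψ _ _ _ h => h a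
  let P : Submonoid (FreeProfiniteMonoid Y) :=
    { carrier := {a | ∃ s, (a, s) ∈ D}
      one_mem' := ⟨1, hone⟩
      mul_mem' := fun ⟨s, hs⟩ ⟨t, ht⟩ => ⟨s * t, hmul _ _ _ _ hs ht⟩ }
  have hP : P = ⊤ := by
    refine eq_top P ?_ fun a => ⟨φ a, hgen a⟩
    have : (P : Set (FreeProfiniteMonoid Y)) = Prod.fst '' D := by
      ext a
      exact ⟨fun ⟨s, hs⟩ => ⟨(a, s), hs, rfl⟩, fun ⟨p, hp, hpa⟩ => ⟨p.2, by rw [← hpa]; exact hp⟩⟩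
    rw [this]
    exact isClosedMap_fst_of_compactSpace _ hD
  have hex : ∀ a, ∃ s, (a, s) ∈ D := fun a => by
    have ha : a ∈ P := hP ▸ Submonoid.mem_top a
    exact ha
  choose g hg using hex
  refine ⟨⟨⟨g, huniq _ _ _ (hg _) hone⟩, fun a b =>
    huniq _ _ _ (hg _) (hmul _ _ _ _ (hg a) (hg b))⟩, ⟨?_, fun a => ?_⟩, ?_⟩
  · refine continuous_iff_isClosed.2 fun C hC => ?_
    have : g ⁻¹' C = Prod.fst '' (D ∩ Prod.snd ⁻¹' C) := by
      ext a
      constructor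
      · exact fun ha => ⟨(a, g a), ⟨hg a, ha⟩, rfl⟩
      · rintro ⟨⟨a', s⟩, ⟨h1, h2⟩, rfl⟩
        change g a' ∈ C
        rwa [huniq _ _ _ (hg a') h1]
    exact this ▸ isClosedMap_fst_of_compactSpace _ (hD.inter (hC.preimage continuous_snd))
  · exact huniq _ _ _ (hg _) (hgen a)
  · rintro ψ ⟨hψ, hψι⟩
    ext a
    refine huniq a _ _ (fun T _ _ χ ψ' _ hχ hψ' h => ?_) (hg a)
    have hE := eq_top (MonoidHom.eqLocusM ψ' (χ.comp ψ)) (isClosed_eq hψ' (hχ.comp hψ)) fun b => by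
      change ψ' (η b) = χ (ψ (η b))
      rw [h b, hψι b]
    have ha : a ∈ MonoidHom.eqLocusM ψ' (χ.comp ψ) := hE ▸ Submonoid.mem_top a
    exact ha

end FreeMonoid

/-! ### The Polish representation -/

section Polish

/-- The algebra structure on a monoid `M` determined by a mapping `γ : Σ → M`:
`w(m₁, …, mₙ) = γ(w) m₁ ⋯ mₙ`. -/
@[reducible]
def kappa (L : FirstOrder.Language.{u, v}) [L.IsAlgebraic] {M : Type w} [Monoid M]
    (γ : (Σ n, L.Functions n) → M) : L.Structure M where
  funMap {n} f m := γ ⟨n, f⟩ * (List.ofFn m).prod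

variable (L : FirstOrder.Language.{u, v}) [L.IsAlgebraic] [∀ n, TopologicalSpace (L.Functions n)]

theorem kappa_isTopologicalAlgebra {M : Type w} [Monoid M] [TopologicalSpace M] [ContinuousMul M]
    (γ : (Σ n, L.Functions n) → M) (hγ : Continuous γ) :
    letI := kappa L γ
    IsTopologicalAlgebra L M := by
  let := kappa L γ
  refine ⟨fun n => ?_⟩
  change Continuous fun p : L.Functions n × (Fin n → M) => γ ⟨n, p.1⟩ * (List.ofFn p.2).prod
  refine (hγ.comp (continuous_sigmaMk.comp continuous_fst)).mul ?_
  simp only [List.ofFn_eq_map]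
  exact continuous_list_prod _ fun k _ => (continuous_apply k).comp continuous_snd

theorem kappa_isProfiniteAlgebra {M : Type w} [Monoid M] [TopologicalSpace M]
    [IsProfiniteMonoid M] (γ : (Σ n, L.Functions n) → M) (hγ : Continuous γ) :
    letI := kappa L γ
    IsProfiniteAlgebra L M := by
  let := kappa L γ
  have := kappa_isTopologicalAlgebra L γ hγ
  refine { nonempty := ⟨1⟩, separated := fun s s' h => ?_ }
  obtain ⟨T, _, _, χ, hT, hT', hχ, hne⟩ := IsProfiniteMonoid.separated s s' h
  let := kappa L (χ ∘ γ)
  refine ⟨T, _, inferInstance, ⟨χ, fun {n} f m => ?_, fun r => isEmptyElim r⟩, hT, hT',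
    kappa_isTopologicalAlgebra L (χ ∘ γ) (hχ.comp hγ), hχ, hne⟩
  change χ (γ ⟨n, f⟩ * (List.ofFn m).prod) = χ (γ ⟨n, f⟩) * (List.ofFn (χ ∘ m)).prod
  rw [map_mul, map_list_prod, List.map_ofFn]

variable (X : Type w) [TopologicalSpace X]

/-- The free profinite monoid over the topological sum `X ∪ Σ`. -/
abbrev PolishMonoid : Type (max u w) := FreeProfiniteMonoid (X ⊕ Σ n, L.Functions n)

/-- The free profinite monoid over `X ∪ Σ` as an algebra:
`w(m₁, …, mₙ) = w m₁ ⋯ mₙ`. -/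
instance polishStructure : L.Structure (PolishMonoid L X) :=
  kappa L fun f => FreeProfiniteMonoid.η (Sum.inr f)

instance : IsProfiniteAlgebra L (PolishMonoid L X) :=
  kappa_isProfiniteAlgebra L _ (FreeProfiniteMonoid.continuous_η.comp continuous_inr)

/-- The closed subalgebra generated by `X` of the free profinite monoid over `X ∪ Σ`. -/
def polishSubalgebra : L.Substructure (PolishMonoid L X) :=
  closedSubalgebra L (Set.range fun a : X => FreeProfiniteMonoid.η (Sum.inl a))

/-- The continuous homomorphism of algebras from the free profinite algebra over `X` to the free
profinite monoid over `X ∪ Σ` that fixes the elements of `X`. -/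
noncomputable def polishHom : FreeProfiniteAlgebra L X →[L] PolishMonoid L X :=
  FreeProfiniteAlgebra.lift (fun a => FreeProfiniteMonoid.η (Sum.inl a))
    (FreeProfiniteMonoid.continuous_η.comp continuous_inl)

theorem polishHom_mem (a : FreeProfiniteAlgebra L X) : polishHom L X a ∈ polishSubalgebra L X := by
  have h : (polishSubalgebra L X).comap (polishHom L X) = ⊤ := by
    refine FreeProfiniteAlgebra.eq_top _ ?_ fun b => ?_
    · exact (isClosed_closedSubalgebra L _).preimage (FreeProfiniteAlgebra.continuous_lift _ _)
    · change polishHom L X (FreeProfiniteAlgebra.ι L b) ∈ polishSubalgebra L X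
      rw [polishHom, FreeProfiniteAlgebra.lift_ι]
      exact subset_closedSubalgebra L _ ⟨b, rfl⟩
  have ha : a ∈ (polishSubalgebra L X).comap (polishHom L X) := h ▸ Substructure.mem_top a
  exact ha

/-- The Polish representation of the free profinite algebra over `X`. -/
noncomputable def polishRepresentation : FreeProfiniteAlgebra L X →[L] polishSubalgebra L X :=
  Hom.codRestrict (polishSubalgebra L X) (polishHom L X) (polishHom_mem L X)

/-- The Polish representation is the only continuous homomorphism that fixes the generators. -/
theorem polishRepresentation_unique (ψ : FreeProfiniteAlgebra L X →[L] polishSubalgebra L X) :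
    ψ = polishRepresentation L X ↔ Continuous ψ ∧ ∀ a : X,
      (ψ (FreeProfiniteAlgebra.ι L a) : PolishMonoid L X) =
        FreeProfiniteMonoid.η (Sum.inl a) := by
  have hc : Continuous (polishRepresentation L X) :=
    Continuous.subtype_mk (FreeProfiniteAlgebra.continuous_lift _ _) _
  have hg : ∀ a : X, (polishRepresentation L X (FreeProfiniteAlgebra.ι L a) : PolishMonoid L X) =
      FreeProfiniteMonoid.η (Sum.inl a) := fun a => FreeProfiniteAlgebra.lift_ι _ _ a
  constructor
  · rintro rfl
    exact ⟨hc, hg⟩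
  · rintro ⟨h, h'⟩
    exact FreeProfiniteAlgebra.hom_ext h hc fun a => Subtype.ext ((h' a).trans (hg a).symm)

end Polish

end PolishRep

namespace PolishRep

open Filter

/-! Polish notation loses the tree structure of terms once limits are taken. Let `g` have arity `k +
2`, let `x` be a generator, and write `e = m!`. The left comb `c` of height `e` over `x` has Polish
word `g^e x x^((k+1)e)`. Compare `a_m = g(c, c, x, …, x)` with `b_m`, the left comb of height `e`
that has `a_m` at its bottom. The word of `b_m` is that of `a_m` with an extra `g^e` in front and an
extra `x^((k+1)e)` behind.

In a finite monoid `g^e` and `x^e` are idempotent for large `m`. Since `a_m` already contains both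
powers next to its ends, the extra factors are absorbed (`kappa_leftComb_absorb`). Hence limits of
`a_m` and `b_m` along one ultrafilter have the same image under the Polish representation
(`eventually_polishHom_eq`).

The limits differ in the free profinite algebra. The second argument at the root is `c` in `a_m` but
`x` in `b_m`, so the path that always turns to the second subterm has length 2 in `a_m` and 1 in
`b_m`. A two-element algebra detects this parity (`secondPathParity`). -/

/-- The powers of `a` are eventually periodic, and for large `m` the number `m!` lies beyond the
preperiod and is a multiple of the period, so doubling the exponent changes nothing. -/
theorem eventually_pow_factorial_mul_self {M : Type*} [Monoid M] [Finite M] (a : M) :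
    ∀ᶠ m : ℕ in atTop, a ^ m.factorial * a ^ m.factorial = a ^ m.factorial := by
  obtain ⟨i, j, hij, h⟩ : ∃ i j : ℕ, i < j ∧ a ^ i = a ^ j := by
    obtain ⟨i, j, h, hne⟩ := Function.not_injective_iff.1
      (not_injective_infinite_finite fun k : ℕ => a ^ k)
    rcases lt_or_gt_of_ne hne with hlt | hlt
    · exact ⟨i, j, hlt, h⟩
    · exact ⟨j, i, hlt, h.symm⟩
  -- Now `j = i + d + 1`, so the period is `d + 1`.
  obtain ⟨d, rfl⟩ := Nat.exists_eq_add_of_lt hij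
  have period : ∀ k, i ≤ k → ∀ q, a ^ (k + (d + 1) * q) = a ^ k := by
    intro k hk q
    obtain ⟨r, rfl⟩ := Nat.exists_eq_add_of_le' hk
    induction q with
    | zero => simp
    | succ q ih =>
      calc a ^ (r + i + (d + 1) * (q + 1)) = a ^ (r + (d + 1) * q) * a ^ (i + d + 1) := by
            rw [← pow_add]; congr 1; ring
        _ = a ^ (r + i + (d + 1) * q) := by rw [← h, ← pow_add]; congr 1; ring
        _ = _ := ih
  filter_upwards [eventually_ge_atTop (i + d + 1)] with m hm
  obtain ⟨q, hq⟩ := Nat.dvd_factorial (Nat.succ_pos d) (show d + 1 ≤ m by omega)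
  have hi : i ≤ m.factorial := le_trans (by omega) (Nat.self_le_factorial m)
  have := period _ hi q
  rwa [← hq, pow_add] at this

/-! ### Comb terms and their images under homomorphisms. -/

section Terms

variable {L : FirstOrder.Language.{u, v}} {S : Type w} [L.Structure S] {k : ℕ}

/-- The binary operation `(y, z) ↦ g(y, z, x, …, x)`. -/
def paddedOp (g : L.Functions (k + 2)) (x y z : S) : S :=
  Structure.funMap g (Matrix.vecCons y (Matrix.vecCons z fun _ => x))

/-- The left comb of height `e`, with `y` at the bottom and all other leaves equal to `x`. -/
def leftComb (g : L.Functions (k + 2)) (x y : S) (e : ℕ) : S :=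
  (fun z => paddedOp g x z x)^[e] y

theorem leftComb_succ (g : L.Functions (k + 2)) (x y : S) (e : ℕ) :
    leftComb g x y (e + 1) = paddedOp g x (leftComb g x y e) x :=
  Function.iterate_succ_apply' _ _ _

variable {T : Type y} [L.Structure T] (φ : S →[L] T)

theorem map_paddedOp (g : L.Functions (k + 2)) (x y z : S) :
    φ (paddedOp g x y z) = paddedOp g (φ x) (φ y) (φ z) := by
  rw [paddedOp, Hom.map_fun, paddedOp]
  congr 1
  funext i
  refine Fin.cases rfl (fun i => Fin.cases rfl (fun i => rfl) i) i

theorem map_leftComb (g : L.Functions (k + 2)) (x y : S) (e : ℕ) :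
    φ (leftComb g x y e) = leftComb g (φ x) (φ y) e := by
  induction e with
  | zero => rfl
  | succ e ih => rw [leftComb_succ, map_paddedOp, ih, leftComb_succ]

end Terms

/-! ### Polish words of combs in a monoid. -/

section Monoid

variable (L : FirstOrder.Language.{u, v}) [L.IsAlgebraic] {M : Type w} [Monoid M]
  (γ : (Σ n, L.Functions n) → M) {k : ℕ} (g : L.Functions (k + 2))

theorem kappa_paddedOp (x y z : M) :
    letI := kappa L γ
    paddedOp g x y z = γ ⟨_, g⟩ * (y * (z * x ^ k)) := by
  change γ ⟨_, g⟩ * (List.ofFn _).prod = _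
  rw [List.ofFn_succ, List.ofFn_succ]
  simp

/-- Each level puts one symbol in front and `k + 1` copies of `x` behind: the second argument and
the `k` padding arguments. -/
theorem kappa_leftComb (x y : M) (e : ℕ) :
    letI := kappa L γ
    leftComb g x y e = γ ⟨_, g⟩ ^ e * y * x ^ ((k + 1) * e) := by
  let := kappa L γ
  induction e with
  | zero => simp [leftComb]
  | succ e ih =>
    rw [leftComb_succ, ih, kappa_paddedOp, pow_succ' _ e, mul_add_one, pow_add x, pow_succ' x k]
    simp only [mul_assoc]

/-- The added prefix and suffix are idempotent powers. Each commutes past the single `g`,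
respectively past the padding `x^k`, and merges with an equal power already in the word. -/
theorem kappa_leftComb_absorb (x : M) {e : ℕ} (hx : x ^ e * x ^ e = x ^ e)
    (hγ : γ ⟨_, g⟩ ^ e * γ ⟨_, g⟩ ^ e = γ ⟨_, g⟩ ^ e) :
    letI := kappa L γ
    leftComb g x (paddedOp g x (leftComb g x x e) (leftComb g x x e)) e =
      paddedOp g x (leftComb g x x e) (leftComb g x x e) := by
  let := kappa L γ
  have hx' : x ^ ((k + 1) * e) * x ^ ((k + 1) * e) = x ^ ((k + 1) * e) := by
    rw [mul_comm, pow_mul, ← (Commute.refl (x ^ e)).mul_pow, hx]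
  rw [kappa_leftComb, kappa_paddedOp, kappa_leftComb]
  generalize γ ⟨_, g⟩ = a at *
  generalize (k + 1) * e = r at *
  have h1 : a ^ e * (a * a ^ e) = a * a ^ e := by
    rw [← pow_succ', pow_succ, ← mul_assoc, hγ]
  have h2 : x ^ r * x ^ k * x ^ r = x ^ r * x ^ k := by
    rw [(Commute.pow_pow_self x r k).eq, mul_assoc, hx']
  calc _ = a ^ e * (a * a ^ e) * x * x ^ r * (a ^ e * x) * (x ^ r * x ^ k * x ^ r) := by
        simp only [mul_assoc]
    _ = _ := by
        rw [h1, h2]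
        simp only [mul_assoc]

end Monoid

/-! ### A finite algebra that tells the two limits apart. -/

section Parity

/-- The algebra on `Bool` in which every operation of arity at least `2` negates its second
argument: it computes the parity of the length of the path that always turns to the second
subterm. -/
@[reducible]
def secondPathParity (L : FirstOrder.Language.{u, v}) [L.IsAlgebraic] : L.Structure Bool where
  funMap {n} _ a := if h : 1 < n then !(a ⟨1, h⟩) else false

theorem secondPathParity_isTopologicalAlgebra (L : FirstOrder.Language.{u, v}) [L.IsAlgebraic]
    [∀ n, TopologicalSpace (L.Functions n)] :
    letI := secondPathParity L
    IsTopologicalAlgebra L Bool := by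
  let := secondPathParity L
  refine ⟨fun n => ?_⟩
  -- The operation depends on the symbol only through its arity, so it factors through the discrete
  -- space `Fin n → Bool`, whatever the topology on the symbols.
  exact (continuous_of_discreteTopology
    (f := fun a : Fin n → Bool => if h : 1 < n then !(a ⟨1, h⟩) else false)).comp continuous_snd

variable (L : FirstOrder.Language.{u, v}) [L.IsAlgebraic] {k : ℕ} (g : L.Functions (k + 2))

theorem secondPathParity_paddedOp (x y z : Bool) :
    letI := secondPathParity L
    paddedOp g x y z = !z := rfl

/-- The second argument at the root of a nontrivial comb is `x`, so the bottom `y` is never seen. -/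
theorem secondPathParity_leftComb (x y : Bool) {e : ℕ} (he : e ≠ 0) :
    letI := secondPathParity L
    leftComb g x y e = !x := by
  let := secondPathParity L
  obtain ⟨e, rfl⟩ := Nat.exists_eq_succ_of_ne_zero he
  rw [leftComb_succ, secondPathParity_paddedOp]

end Parity

/-! ### Agreement of the Polish images and the conclusion. -/

/-- The bound on `m` depends on the coordinate `i`, so the images are only compared one finite
monoid at a time; this suffices for equality of limits in the product. -/
theorem eventually_polishHom_eq (L : FirstOrder.Language.{u, v}) [L.IsAlgebraic]
    [∀ n, TopologicalSpace (L.Functions n)] {X : Type w} [TopologicalSpace X] {k : ℕ}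
    (g : L.Functions (k + 2)) (s : FreeProfiniteAlgebra L X)
    (i : FiniteMonoidOver (X ⊕ Σ n, L.Functions n)) :
    ∀ᶠ m : ℕ in atTop,
      (polishHom L X (leftComb g s (paddedOp g s (leftComb g s s m.factorial)
        (leftComb g s s m.factorial)) m.factorial)).1 i =
      (polishHom L X (paddedOp g s (leftComb g s s m.factorial)
        (leftComb g s s m.factorial))).1 i := by
  let γ : (Σ n, L.Functions n) → i.Carrier := fun f => i.map (Sum.inr f)
  let := kappa L γ
  let π : PolishMonoid L X →* i.Carrier := (Pi.evalMonoidHom _ i).comp (Submonoid.subtype _)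
  -- The projection to a coordinate is also a homomorphism for the Polish operations, so both terms
  -- can be evaluated inside the finite monoid.
  let ψ : PolishMonoid L X →[L] i.Carrier :=
    ⟨π, fun {n} f a => by
      change π (FreeProfiniteMonoid.η (Sum.inr ⟨n, f⟩) * (List.ofFn a).prod) =
        γ ⟨n, f⟩ * (List.ofFn (π ∘ a)).prod
      rw [map_mul, map_list_prod, List.map_ofFn]
      rfl, fun r => isEmptyElim r⟩
  filter_upwards [eventually_pow_factorial_mul_self (ψ (polishHom L X s)),
    eventually_pow_factorial_mul_self (γ ⟨_, g⟩)] with m h1 h2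
  change ψ (polishHom L X _) = ψ (polishHom L X _)
  simp only [map_leftComb, map_paddedOp]
  exact kappa_leftComb_absorb L γ g _ h1 h2

end PolishRep

open PolishRep Filter in
theorem proposition7p3 (L : FirstOrder.Language.{u, v}) [L.IsAlgebraic]
    [∀ n, TopologicalSpace (L.Functions n)] (X : Type w) [TopologicalSpace X] [Nonempty X]
    (n : ℕ) (hn : 2 ≤ n) (hL : Nonempty (L.Functions n)) :
    ¬ Function.Injective (PolishRep.polishRepresentation L X) := by
  obtain ⟨k, rfl⟩ := Nat.exists_eq_add_of_le' hn
  obtain ⟨g⟩ := hL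
  let s : FreeProfiniteAlgebra L X := FreeProfiniteAlgebra.ι L (Classical.arbitrary X)
  let a : ℕ → FreeProfiniteAlgebra L X := fun m =>
    paddedOp g s (leftComb g s s m.factorial) (leftComb g s s m.factorial)
  let b : ℕ → FreeProfiniteAlgebra L X := fun m => leftComb g s (a m) m.factorial
  -- Compactness provides limits along any ultrafilter, with no need for convergent subsequences.
  -- Using the same free ultrafilter for both sequences lets eventual equalities pass to the limits.
  let U : Ultrafilter ℕ := hyperfilter ℕ
  have hU : (U : Filter ℕ) ≤ atTop := Nat.hyperfilter_le_atTop
  obtain ⟨A, hA⟩ : ∃ A, Tendsto a U (nhds A) := ⟨_, (U.map a).le_nhds_lim⟩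
  obtain ⟨B, hB⟩ : ∃ B, Tendsto b U (nhds B) := ⟨_, (U.map b).le_nhds_lim⟩
  have hΦ : Continuous (polishHom L X) := FreeProfiniteAlgebra.continuous_lift _ _
  have heq : polishHom L X B = polishHom L X A := by
    refine Subtype.ext (funext fun i => ?_)
    have hπ : Continuous fun c : FreeProfiniteAlgebra L X => (polishHom L X c).1 i :=
      (continuous_apply i).comp (continuous_subtype_val.comp hΦ)
    refine tendsto_nhds_unique_of_eventuallyEq ((hπ.tendsto B).comp hB) ((hπ.tendsto A).comp hA) ?_
    exact (eventually_polishHom_eq L g s i).filter_mono hU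
  intro hinj
  have hBA : B = A := hinj (Subtype.ext heq)
  let := secondPathParity L
  have := secondPathParity_isTopologicalAlgebra L
  obtain ⟨ψ, hψ, hψι⟩ := FreeProfiniteAlgebra.exists_lift_finite (L := L) (X := X) Bool
    (fun _ => false) continuous_const
  have hs : ψ s = false := hψι _
  -- Two negations of `false`: one at the root, one at the root of the comb in second position.
  have ha : ∀ m, ψ (a m) = false := fun m => by
    change ψ (paddedOp g s _ _) = false
    rw [map_paddedOp, map_leftComb, secondPathParity_paddedOp,
      secondPathParity_leftComb L g _ _ (Nat.factorial_ne_zero m), hs]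
    rfl
  -- Only one negation: as `m! ≠ 0`, the second argument at the root is `s` itself.
  have hb : ∀ m, ψ (b m) = true := fun m => by
    change ψ (leftComb g s _ _) = true
    rw [map_leftComb, secondPathParity_leftComb L g _ _ (Nat.factorial_ne_zero m), hs]
    rfl
  have hψA : ψ A = false :=
    tendsto_nhds_unique ((hψ.tendsto A).comp hA) (tendsto_const_nhds.congr fun m => (ha m).symm)
  have hψB : ψ B = true :=
    tendsto_nhds_unique ((hψ.tendsto B).comp hB) (tendsto_const_nhds.congr fun m => (hb m).symm)
  rw [hBA, hψA] at hψB
  exact Bool.false_ne_true hψB
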